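/- For an $n\times n$ complex matrix $M$ let $s_1(M)\ge\cdots\ge s_n(M)\ge 0$ be its singular values, i.e. the eigenvalues of $|M|=(M^*M)^{1/2}$ in decreasing order with multiplicity, and write $s(M)=(s_1(M),\dots,s_n(M))$. For vectors $x,y\in[0,\infty)^n$ write $y\succ_{\log}x$ if $$\prod_{j=1}^k x_j\le\prod_{j=1}^k y_j\quad(1\le k<n)\qquad\text{and}\qquad \prod_{j=1}^n x_j=\prod_{j=1}^n y_j ,$$ where the entries are taken in the given order (no rearrangement). Powers and products of vectors are taken entrywise: $s^{p}(M)s^{q}(N)$ is the vector with entries $s_j(M)^{p}\,s_j(N)^{q}$. **Theorem.** Let $A,B$ be positive definite $n\times n$ complex matrices, let $X$ be any $n\times n$ complex matrix, and let $r\ge 0$ be real. Then (i) $s(A^{1+r}XB^{1+r})\succ_{\log}s^{1+r}(AXB)\,s^{-r}(X)$; (ii) $s(A^{1+r}XB^{-r})\succ_{\log}s^{1+r}(AX)\,s^{-r}(XB)$. If $X$ is singular, an entry of the right-hand vector in which $s_j(X)=0$ in (i), or $s_j(XB)=0$ in (ii), is read as $0$; for such $j$ one also has $s_j(AXB)=0$,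 respectively $s_j(AX)=0$. -/

import Mathlib

open scoped MatrixOrder ComplexOrder

/-- The singular values `s₁(M) ≥ ⋯ ≥ sₙ(M)` of a complex `n × n` matrix, in decreasing order and
with multiplicity: the square roots of the eigenvalues of `Mᴴ * M`, that is, the eigenvalues of
`|M| = (Mᴴ * M)^(1/2)`. The index is zero-based: `singularValueVector M j` is `s_{j+1}(M)`. -/
noncomputable def singularValueVector {n : ℕ} (M : Matrix (Fin n) (Fin n) ℂ) : Fin n → ℝ :=
  fun j => (Matrix.toEuclideanLin M).singularValues j

/-- `LogMajorizes y x` is `y ≻_log x` for nonnegative vectors `x`, `y`: for every `1 ≤ k < n` the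
product of the first `k` entries of `x` is at most that of `y`, and the products of all entries
agree. The entries are taken in the order of their index; nothing is rearranged. -/
def LogMajorizes {n : ℕ} (y x : Fin n → ℝ) : Prop :=
  (∀ k : ℕ, 1 ≤ k → k < n →
    ∏ j ∈ Finset.univ.filter (fun j : Fin n => (j : ℕ) < k), x j ≤
      ∏ j ∈ Finset.univ.filter (fun j : Fin n => (j : ℕ) < k), y j) ∧
  ∏ j : Fin n, x j = ∏ j : Fin n, y j

open Matrix

/-! The product of the k largest singular values of `M` is the maximum of `|det (Uᴴ M V)|` over n×k
isometries `U`, `V` (`norm_det_compression_le`, `exists_norm_det_compression_eq`). Choose `U`, `V`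
optimal for `A X B`, put `p = 1 + r`, and consider the entire function `f z = det (Uᴴ A^(pz) X
B^(pz) V)`. Imaginary powers of `A` and `B` are unitary and can be absorbed into `U` and `V`, so
`|f|` is at most the k-fold product for `X` on `Re z = 0` and that for `A^p X B^p` on `Re z = 1`.
Hadamard's three lines theorem at `z = 1/p` gives `prod_singularValueVector_le_interp`, whose power
`1 + r` is (i) for k < n. For k = n both sides are determinants. Part (ii) is (i) with `X B` and
`B⁻¹` in place of `X` and `B`. -/

/-! ### Determinants and the Loewner order. -/

theorem Matrix.PosSemidef.one_le_det_one_add {ι : Type*} [Fintype ι] [DecidableEq ι]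
    {E : Matrix ι ι ℂ} (hE : E.PosSemidef) : 1 ≤ (1 + E).det := by
  have h := hE.1.spectral_theorem
  rw [Unitary.conjStarAlgAut_apply] at h
  set U : Matrix ι ι ℂ := (hE.1.eigenvectorUnitary : Matrix ι ι ℂ) with hU
  have hUU : U * star U = 1 := Unitary.coe_mul_star_self _
  have h1 : 1 + E = U * (1 + diagonal (RCLike.ofReal ∘ hE.1.eigenvalues)) * star U := by
    rw [mul_add, add_mul, mul_one, hUU, ← h]
  have h2 : (1 + E).det = ((∏ i, (1 + hE.1.eigenvalues i) : ℝ) : ℂ) := by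
    rw [h1, det_mul_right_comm, hUU, one_mul, ← diagonal_one, diagonal_add, det_diagonal]
    simp
  rw [h2]
  have : (1 : ℝ) ≤ ∏ i, (1 + hE.1.eigenvalues i) :=
    Finset.prod_induction _ (fun x : ℝ => 1 ≤ x) (fun _ _ => one_le_mul_of_one_le_of_one_le) le_rfl
      fun i _ => by linarith [hE.eigenvalues_nonneg i]
  exact_mod_cast this

/-- For invertible `P = Sᴴ S`, congruence by `S⁻¹` turns `Q` into `1 + E` with `E` positive
semidefinite, and `det (1 + E) ≥ 1`. -/
theorem Matrix.PosSemidef.det_le_det {ι : Type*} [Fintype ι] [DecidableEq ι]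
    {P Q : Matrix ι ι ℂ} (hP : P.PosSemidef) (hPQ : P ≤ Q) : P.det ≤ Q.det := by
  have hQ : Q.PosSemidef := by
    rw [← nonneg_iff_posSemidef] at hP ⊢; exact hP.trans hPQ
  by_cases h0 : P.det = 0
  · rw [h0]; exact hQ.det_nonneg
  obtain ⟨S, hS⟩ := CStarAlgebra.nonneg_iff_eq_star_mul_self.mp (nonneg_iff_posSemidef.mpr hP)
  rw [star_eq_conjTranspose] at hS
  have hSu : IsUnit S.det := by
    rw [isUnit_iff_ne_zero]; rintro h; apply h0; rw [hS, det_mul, h, mul_zero]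
  have h1 : S⁻¹ * S = 1 := nonsing_inv_mul S hSu
  have h2 : Sᴴ * (S⁻¹)ᴴ = 1 := by rw [← conjTranspose_mul, h1, conjTranspose_one]
  have hE := (le_iff.mp hPQ).conjTranspose_mul_mul_same S⁻¹
  have hQe : Q = Sᴴ * (1 + (S⁻¹)ᴴ * (Q - P) * S⁻¹) * S := by
    have : Sᴴ * (1 + (S⁻¹)ᴴ * (Q - P) * S⁻¹) * S
        = Sᴴ * S + (Sᴴ * (S⁻¹)ᴴ) * (Q - P) * (S⁻¹ * S) := by noncomm_ring
    rw [this, h1, h2, ← hS]; simp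
  have hd : Q.det = P.det * (1 + (S⁻¹)ᴴ * (Q - P) * S⁻¹).det := by
    conv_lhs => rw [hQe]
    rw [hS, det_mul, det_mul, det_mul]; ring
  rw [hd]
  exact le_mul_of_one_le_right hP.det_nonneg hE.one_le_det_one_add

theorem Matrix.mul_conjTranspose_le_one {ι κ : Type*} [Fintype ι] [DecidableEq ι] [Fintype κ]
    [DecidableEq κ] {V : Matrix ι κ ℂ} (hV : Vᴴ * V = 1) : V * Vᴴ ≤ 1 := by
  rw [le_iff]
  have : 1 - V * Vᴴ = (1 - V * Vᴴ)ᴴ * (1 - V * Vᴴ) := by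
    have h : V * Vᴴ * (V * Vᴴ) = V * Vᴴ := by
      rw [Matrix.mul_assoc, ← Matrix.mul_assoc Vᴴ, hV, Matrix.one_mul]
    simp [Matrix.sub_mul, Matrix.mul_sub, h]
  rw [this]
  exact posSemidef_conjTranspose_mul_self _

theorem Matrix.conjTranspose_mul_mul_le {ι κ : Type*} [Fintype ι] [Fintype κ]
    {P Q : Matrix ι ι ℂ} (h : P ≤ Q) (V : Matrix ι κ ℂ) : Vᴴ * P * V ≤ Vᴴ * Q * V := by
  rw [le_iff] at h ⊢
  simpa [Matrix.mul_sub, Matrix.sub_mul] using h.conjTranspose_mul_mul_same V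

/-! ### Determinants of compressions of a diagonal matrix. -/

/-- Raising `d` to `max d c = c (1 + e)` only increases the determinant. Since `e` vanishes from
index `k` on, its compression involves only the top k×k block `W` of `V`. With `F² = diag e` on that
block, `det (1 + Wᴴ F² W) = det (1 + F W Wᴴ F) ≤ det (1 + F²)`, because `W Wᴴ ≤ 1`. -/
theorem det_compression_diagonal_le_of_pos {n k : ℕ} (hk : k ≤ n) (d : Fin n → ℝ) (hd : ∀ i, 0 ≤ d i)
    {c : ℝ} (hc : 0 < c) (hdc : ∀ j : Fin n, k ≤ (j : ℕ) → d j ≤ c)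
    {V : Matrix (Fin n) (Fin k) ℂ} (hV : Vᴴ * V = 1) :
    (Vᴴ * diagonal (fun j => (d j : ℂ)) * V).det ≤
      ((∏ i : Fin k, max (d (Fin.castLE hk i)) c : ℝ) : ℂ) := by
  set e : Fin n → ℝ := fun j => max (d j) c / c - 1 with he
  have he0 : ∀ j, 0 ≤ e j := fun j => by
    rw [he]; simp only [sub_nonneg]; rw [le_div_iff₀ hc]; simp
  have hev : ∀ j : Fin n, k ≤ (j : ℕ) → e j = 0 := fun j hj => by
    simp only [he]; rw [max_eq_right (hdc j hj), div_self hc.ne', sub_self]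
  have hce : ∀ j, c * (1 + e j) = max (d j) c := fun j => by
    simp only [he]; field_simp; ring
  set F : Matrix (Fin k) (Fin k) ℂ := diagonal fun i => (√(e (Fin.castLE hk i)) : ℂ) with hF
  set W : Matrix (Fin k) (Fin k) ℂ := V.submatrix (Fin.castLE hk) id with hW
  have hFF : F * F = diagonal fun i => (e (Fin.castLE hk i) : ℂ) := by
    rw [hF, diagonal_mul_diagonal]; congr 1; ext i
    rw [← Complex.ofReal_mul, Real.mul_self_sqrt (he0 _)]
  have hFh : Fᴴ = F := by
    rw [hF, diagonal_conjTranspose]; congr 1; ext i; simp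
  have hsum : Vᴴ * diagonal (fun j => (e j : ℂ)) * V = Wᴴ * (F * F) * W := by
    rw [hFF]; ext a b
    rw [mul_apply, mul_apply]
    simp only [mul_diagonal, conjTranspose_apply, hW, submatrix_apply, id]
    symm
    refine Finset.sum_of_injOn (Fin.castLE hk) (Fin.castLE_injective hk).injOn (by simp) ?_ (by simp)
    intro j _ hj
    have : k ≤ (j : ℕ) := by
      by_contra hlt
      exact hj ⟨⟨j, by omega⟩, by simp, by ext; simp⟩
    rw [hev j this]; simp
  have h1 : Vᴴ * diagonal (fun j => (d j : ℂ)) * V ≤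
      (c : ℂ) • (1 + Wᴴ * (F * F) * W) := by
    have : (c : ℂ) • (1 + Wᴴ * (F * F) * W)
        = Vᴴ * diagonal (fun j => ((max (d j) c : ℝ) : ℂ)) * V := by
      rw [← hsum, ← hV]
      have : diagonal (fun j => ((max (d j) c : ℝ) : ℂ))
          = (c : ℂ) • (1 + diagonal (fun j => (e j : ℂ))) := by
        rw [← diagonal_one, diagonal_add, ← diagonal_smul]; congr 1; ext j
        simp [← hce j]
      rw [this]
      simp [Matrix.mul_add, Matrix.add_mul]
    rw [this]
    apply conjTranspose_mul_mul_le
    rw [le_iff, diagonal_sub, posSemidef_diagonal_iff]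
    intro j
    rw [← Complex.ofReal_sub]
    exact_mod_cast sub_nonneg.mpr (le_max_left _ _)
  have hD0 : (diagonal (fun j => (d j : ℂ))).PosSemidef := by
    rw [posSemidef_diagonal_iff]; intro j; exact_mod_cast hd j
  have h2 := (hD0.conjTranspose_mul_mul_same V).det_le_det h1
  refine h2.trans ?_
  have hWW : W * Wᴴ ≤ 1 := by
    have := (le_iff.mp (mul_conjTranspose_le_one hV)).submatrix (Fin.castLE hk)
    rw [le_iff]
    convert this using 1
    ext a b
    simp [hW, mul_apply, one_apply, (Fin.castLE_injective hk).eq_iff]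
  have h3 : (1 + Wᴴ * (F * F) * W).det ≤ (1 + F * F).det := by
    have h4 : Wᴴ * (F * F) * W = (Wᴴ * F) * (F * W) := by simp only [Matrix.mul_assoc]
    rw [h4, det_one_add_mul_comm]
    have h5 : F * W * (Wᴴ * F) = Fᴴ * (W * Wᴴ) * F := by rw [hFh]; simp only [Matrix.mul_assoc]
    have h6 : Fᴴ * (W * Wᴴ) * F ≤ F * F := by
      simpa [hFh] using conjTranspose_mul_mul_le hWW F
    rw [h5]
    refine PosSemidef.det_le_det (PosSemidef.one.add
      ((posSemidef_self_mul_conjTranspose W).conjTranspose_mul_mul_same F)) ?_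
    exact add_le_add_right h6 1
  rw [det_smul, Fintype.card_fin]
  have hck : (0 : ℂ) ≤ (c : ℂ) ^ k := by exact_mod_cast (pow_pos hc k).le
  refine (mul_le_mul_of_nonneg_left h3 hck).trans (le_of_eq ?_)
  rw [hFF, ← diagonal_one, diagonal_add, det_diagonal]
  simp only [← hce]
  rw [Finset.prod_mul_distrib]
  simp

theorem det_compression_diagonal_le {n k : ℕ} (hk : k ≤ n) (d : Fin n → ℝ) (hd : ∀ i, 0 ≤ d i)
    (hanti : Antitone d) {V : Matrix (Fin n) (Fin k) ℂ} (hV : Vᴴ * V = 1) :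
    (Vᴴ * diagonal (fun j => (d j : ℂ)) * V).det.re ≤ ∏ i : Fin k, d (Fin.castLE hk i) := by
  rcases Nat.eq_zero_or_pos k with rfl | hk0
  · simp
  -- The threshold is `c = d l + ε` with `l` the last retained index; `ε > 0` keeps it positive when
  -- `d l = 0`, and then tends to `0`.
  set l : Fin n := ⟨k - 1, by omega⟩ with hl
  have key : ∀ ε > 0, (Vᴴ * diagonal (fun j => (d j : ℂ)) * V).det.re ≤
      ∏ i : Fin k, (d (Fin.castLE hk i) + ε) := fun ε hε => by
    have h := det_compression_diagonal_le_of_pos hk d hd (c := d l + ε) (by linarith [hd l])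
      (fun j hj => by
        have : d j ≤ d l := hanti (by rw [Fin.le_def, hl]; simp; omega)
        linarith) hV
    have h' := (Complex.le_def.mp h).1
    rw [Complex.ofReal_re] at h'
    refine h'.trans (Finset.prod_le_prod (fun i _ => le_max_of_le_left (hd _)) fun i _ => ?_)
    have : d l ≤ d (Fin.castLE hk i) := hanti (by rw [Fin.le_def, hl]; simp; omega)
    exact max_le (by linarith) (by linarith)
  have hcont : Filter.Tendsto (fun ε : ℝ => ∏ i : Fin k, (d (Fin.castLE hk i) + ε))
      (nhdsWithin 0 (Set.Ioi 0)) (nhds (∏ i : Fin k, d (Fin.castLE hk i))) := by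
    have : Continuous fun ε : ℝ => ∏ i : Fin k, (d (Fin.castLE hk i) + ε) := by fun_prop
    have h := (this.tendsto 0).mono_left (nhdsWithin_le_nhds (s := Set.Ioi 0))
    simpa using h
  exact ge_of_tendsto hcont (by filter_upwards [self_mem_nhdsWithin] with ε hε using key ε hε)

/-! ### Variational description of products of singular values. -/

theorem singularValueVector_nonneg {n : ℕ} (M : Matrix (Fin n) (Fin n) ℂ) (j : Fin n) :
    0 ≤ singularValueVector M j := LinearMap.singularValues_nonneg _ _

theorem singularValueVector_antitone {n : ℕ} (M : Matrix (Fin n) (Fin n) ℂ) :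
    Antitone (singularValueVector M) := fun _ _ h => LinearMap.singularValues_antitone _ h

theorem exists_conjTranspose_mul_self_eq_diagonal {n : ℕ} (M : Matrix (Fin n) (Fin n) ℂ) :
    ∃ Q : Matrix (Fin n) (Fin n) ℂ, Qᴴ * Q = 1 ∧ Q * Qᴴ = 1 ∧
      Mᴴ * M = Q * diagonal (fun j => ((singularValueVector M j ^ 2 : ℝ) : ℂ)) * Qᴴ := by
  set T := Matrix.toEuclideanLin M with hT
  have hn : Module.finrank ℂ (EuclideanSpace ℂ (Fin n)) = n := by simp
  set b := T.isSymmetric_adjoint_comp_self.eigenvectorBasis hn with hb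
  set Q : Matrix (Fin n) (Fin n) ℂ := of fun i j => b j i with hQ
  have h1 : Qᴴ * Q = 1 := by
    ext i j
    have := orthonormal_iff_ite.mp b.orthonormal i j
    rw [EuclideanSpace.inner_eq_star_dotProduct] at this
    rw [one_apply, ← this]
    simp [mul_apply, dotProduct, hQ, mul_comm]
  have h2 : Q * Qᴴ = 1 := mul_eq_one_comm.mp h1
  refine ⟨Q, h1, h2, ?_⟩
  have h3 : Mᴴ * M * Q = Q * diagonal (fun j => ((singularValueVector M j ^ 2 : ℝ) : ℂ)) := by
    ext i j
    have h := T.isSymmetric_adjoint_comp_self.apply_eigenvectorBasis hn j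
    rw [← LinearMap.sq_singularValues_fin, ← hb, hT, ← toEuclideanLin_conjTranspose_eq_adjoint] at h
    have h' := congrArg (fun v => v i) h
    simp only [LinearMap.comp_apply, toLpLin_apply, PiLp.smul_apply, mulVec_mulVec] at h'
    rw [mul_diagonal]
    simp only [mulVec, dotProduct] at h'
    rw [mul_apply]
    simp only [hQ, of_apply]
    rw [h']
    simp [singularValueVector, mul_comm]
  rw [← h3, Matrix.mul_assoc, h2, Matrix.mul_one]

theorem prod_singularValueVector {n : ℕ} (M : Matrix (Fin n) (Fin n) ℂ) :
    ∏ j, singularValueVector M j = ‖M.det‖ := by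
  obtain ⟨Q, h1, h2, h⟩ := exists_conjTranspose_mul_self_eq_diagonal M
  have hd := congrArg det h
  rw [det_mul_right_comm, h2, one_mul, det_diagonal, det_mul, det_conjTranspose] at hd
  have h3 : ‖M.det‖ ^ 2 = (∏ j, singularValueVector M j) ^ 2 := by
    have := congrArg norm hd
    rw [norm_mul, norm_star, ← Complex.ofReal_prod, Complex.norm_real, Finset.prod_pow,
      Real.norm_of_nonneg (sq_nonneg _)] at this
    rw [← this]; ring
  exact ((pow_left_inj₀ (norm_nonneg _)
    (Finset.prod_nonneg fun j _ => singularValueVector_nonneg M j) two_ne_zero).mp h3).symm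

/-- Since `U Uᴴ ≤ 1`, `|det (Uᴴ M V)|²` is at most `det (Vᴴ Mᴴ M V)`, a compression of the
diagonalized `Mᴴ M`. -/
theorem norm_det_compression_le {n k : ℕ} (hk : k ≤ n) (M : Matrix (Fin n) (Fin n) ℂ)
    {U V : Matrix (Fin n) (Fin k) ℂ} (hU : Uᴴ * U = 1) (hV : Vᴴ * V = 1) :
    ‖(Uᴴ * M * V).det‖ ≤ ∏ i : Fin k, singularValueVector M (Fin.castLE hk i) := by
  obtain ⟨Q, h1, h2, h⟩ := exists_conjTranspose_mul_self_eq_diagonal M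
  have hQV : (Qᴴ * V)ᴴ * (Qᴴ * V) = 1 := by
    rw [conjTranspose_mul, conjTranspose_conjTranspose, Matrix.mul_assoc, ← Matrix.mul_assoc Q, h2,
      Matrix.one_mul, hV]
  have hb := det_compression_diagonal_le hk (fun j => singularValueVector M j ^ 2)
    (fun _ => sq_nonneg _) (fun i j hij => pow_le_pow_left₀ (singularValueVector_nonneg M j)
      (singularValueVector_antitone M hij) 2) hQV
  have he : (Qᴴ * V)ᴴ *
      (diagonal (fun j => ((singularValueVector M j ^ 2 : ℝ) : ℂ)) : Matrix (Fin n) (Fin n) ℂ) *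
      (Qᴴ * V) = (M * V)ᴴ * (1 : Matrix (Fin n) (Fin n) ℂ) * (M * V) := by
    rw [conjTranspose_mul, conjTranspose_conjTranspose, conjTranspose_mul, Matrix.mul_one]
    calc _ = Vᴴ * (Q * diagonal (fun j => ((singularValueVector M j ^ 2 : ℝ) : ℂ)) * Qᴴ) * V := by
          simp only [Matrix.mul_assoc]
      _ = _ := by rw [← h]; simp only [Matrix.mul_assoc]
  rw [he, Finset.prod_pow] at hb
  have hle : (M * V)ᴴ * (U * Uᴴ) * (M * V) ≤ (M * V)ᴴ * (1 : Matrix (Fin n) (Fin n) ℂ) * (M * V) :=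
    conjTranspose_mul_mul_le (mul_conjTranspose_le_one hU) _
  have hdet := (Complex.le_def.mp (PosSemidef.det_le_det
    ((posSemidef_self_mul_conjTranspose U).conjTranspose_mul_mul_same (M * V)) hle)).1
  have hsq : ((M * V)ᴴ * (U * Uᴴ) * (M * V)).det.re = ‖(Uᴴ * M * V).det‖ ^ 2 := by
    have : (M * V)ᴴ * (U * Uᴴ) * (M * V) = (Uᴴ * M * V)ᴴ * (Uᴴ * M * V) := by
      simp only [conjTranspose_mul, conjTranspose_conjTranspose, Matrix.mul_assoc]
    rw [this, det_mul, det_conjTranspose]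
    rw [Complex.star_def, ← Complex.normSq_eq_conj_mul_self, Complex.ofReal_re, Complex.normSq_eq_norm_sq]
  rw [hsq] at hdet
  exact (pow_le_pow_iff_left₀ (norm_nonneg _)
    (Finset.prod_nonneg fun j _ => singularValueVector_nonneg M _) two_ne_zero).mp (hdet.trans hb)

/-- `V` consists of the first k right singular vectors and `U = M V diag(1/s)` of the matching left
ones; the nonvanishing hypothesis allows the division. -/
theorem exists_norm_det_compression_eq {n k : ℕ} (hk : k ≤ n) (M : Matrix (Fin n) (Fin n) ℂ)
    (hM : ∏ i : Fin k, singularValueVector M (Fin.castLE hk i) ≠ 0) :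
    ∃ U V : Matrix (Fin n) (Fin k) ℂ, Uᴴ * U = 1 ∧ Vᴴ * V = 1 ∧
      ‖(Uᴴ * M * V).det‖ = ∏ i : Fin k, singularValueVector M (Fin.castLE hk i) := by
  obtain ⟨Q, h1, h2, h⟩ := exists_conjTranspose_mul_self_eq_diagonal M
  set s : Fin k → ℝ := fun i => singularValueVector M (Fin.castLE hk i) with hs
  have hs0 : ∀ i, (s i : ℂ) ≠ 0 := fun i => by
    exact_mod_cast Finset.prod_ne_zero_iff.mp hM i (Finset.mem_univ i)
  set V : Matrix (Fin n) (Fin k) ℂ := Q.submatrix id (Fin.castLE hk) with hVdef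
  have hdiag : ∀ N : Matrix (Fin n) (Fin n) ℂ,
      Vᴴ * N * V = (Qᴴ * N * Q).submatrix (Fin.castLE hk) (Fin.castLE hk) := fun N => by
    ext a b; simp [hVdef, mul_apply]
  have hV : Vᴴ * V = 1 := by
    have := hdiag 1
    rw [Matrix.mul_one, Matrix.mul_one, h1, submatrix_one _ (Fin.castLE_injective hk)] at this
    exact this
  have hMV : Vᴴ * (Mᴴ * M) * V = diagonal fun i => (s i : ℂ) ^ 2 := by
    rw [hdiag, h]
    have : Qᴴ * (Q * diagonal (fun j => ((singularValueVector M j ^ 2 : ℝ) : ℂ)) * Qᴴ) * Q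
        = (Qᴴ * Q) * diagonal (fun j => ((singularValueVector M j ^ 2 : ℝ) : ℂ)) * (Qᴴ * Q) := by
      simp only [Matrix.mul_assoc]
    rw [this, h1, Matrix.one_mul, Matrix.mul_one, submatrix_diagonal _ _ (Fin.castLE_injective hk)]
    congr 1; ext i; simp [hs]
  set G : Matrix (Fin k) (Fin k) ℂ := diagonal fun i => (s i : ℂ)⁻¹ with hG
  have hGh : Gᴴ = G := by
    rw [hG, diagonal_conjTranspose]; congr 1; ext i; simp
  have hUM : (M * V * G)ᴴ * M * V = diagonal fun i => (s i : ℂ) := by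
    have : (M * V * G)ᴴ * M * V = G * (Vᴴ * (Mᴴ * M) * V) := by
      simp only [conjTranspose_mul, hGh, Matrix.mul_assoc]
    rw [this, hMV, hG, diagonal_mul_diagonal]
    congr 1; ext i; have := hs0 i; field_simp
  refine ⟨M * V * G, V, ?_, hV, ?_⟩
  · have : (M * V * G)ᴴ * (M * V * G) = ((M * V * G)ᴴ * M * V) * G := by
      simp only [Matrix.mul_assoc]
    rw [this, hUM, hG, diagonal_mul_diagonal, ← diagonal_one]
    congr 1; ext i; exact mul_inv_cancel₀ (hs0 i)
  · rw [hUM, det_diagonal, ← Complex.ofReal_prod, Complex.norm_real, Real.norm_of_nonneg]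
    exact Finset.prod_nonneg fun j _ => singularValueVector_nonneg M _

/-! ### Complex powers of positive definite matrices. -/

/-- The matrix `P diag(a ^ z) Pᴴ`, a complex power of `P diag(a) Pᴴ` when `P` is unitary. -/
noncomputable def diagonalizedCpow {ι : Type*} [Fintype ι] [DecidableEq ι] (P : Matrix ι ι ℂ)
    (a : ι → ℝ) (z : ℂ) : Matrix ι ι ℂ :=
  P * diagonal (fun j => (a j : ℂ) ^ z) * Pᴴ

section diagonalizedCpow

variable {ι : Type*} [Fintype ι] [DecidableEq ι] {P : Matrix ι ι ℂ} {a : ι → ℝ}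

theorem diagonalizedCpow_add (hP : Pᴴ * P = 1) (ha : ∀ j, 0 < a j) (z w : ℂ) :
    diagonalizedCpow P a (z + w) = diagonalizedCpow P a z * diagonalizedCpow P a w := by
  have h : diagonalizedCpow P a z * diagonalizedCpow P a w
      = P * (diagonal (fun j => (a j : ℂ) ^ z) * (Pᴴ * P) * diagonal (fun j => (a j : ℂ) ^ w))
        * Pᴴ := by
    simp only [diagonalizedCpow, Matrix.mul_assoc]
  rw [h, hP, Matrix.mul_one, diagonal_mul_diagonal, diagonalizedCpow]
  congr 3; ext j
  exact Complex.cpow_add _ _ (by exact_mod_cast (ha j).ne')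

theorem diagonalizedCpow_zero (hP : P * Pᴴ = 1) : diagonalizedCpow P a 0 = 1 := by
  simp [diagonalizedCpow, hP]

theorem conjTranspose_diagonalizedCpow (ha : ∀ j, 0 < a j) (z : ℂ) :
    (diagonalizedCpow P a z)ᴴ = diagonalizedCpow P a (star z) := by
  simp only [diagonalizedCpow, conjTranspose_mul, conjTranspose_conjTranspose,
    diagonal_conjTranspose, Matrix.mul_assoc]
  congr 3; ext j
  have : Complex.arg (a j : ℂ) ≠ Real.pi := by
    rw [Complex.arg_ofReal_of_nonneg (ha j).le]; exact Real.pi_ne_zero.symm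
  simp only [Pi.star_apply, Complex.star_def]
  rw [Complex.cpow_conj _ _ this, Complex.conj_ofReal]

theorem conjTranspose_mul_diagonalizedCpow_I (hP : Pᴴ * P = 1) (hP' : P * Pᴴ = 1)
    (ha : ∀ j, 0 < a j) (y : ℝ) :
    (diagonalizedCpow P a (y * Complex.I))ᴴ * diagonalizedCpow P a (y * Complex.I) = 1 := by
  rw [conjTranspose_diagonalizedCpow ha, ← diagonalizedCpow_add hP ha, ← diagonalizedCpow_zero hP']
  congr 1; simp

theorem differentiable_diagonalizedCpow_apply (ha : ∀ j, 0 < a j) (p : ℂ) (i j : ι) :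
    Differentiable ℂ fun z => diagonalizedCpow P a (p * z) i j := by
  simp only [diagonalizedCpow]
  simp only [mul_apply (N := Pᴴ), mul_diagonal]
  have : ∀ j, (a j : ℂ) ≠ 0 := fun j => by exact_mod_cast (ha j).ne'
  refine Differentiable.fun_sum fun l _ => Differentiable.mul_const (Differentiable.const_mul ?_ _) _
  exact (differentiable_id.const_mul p).const_cpow (Or.inl (this l))

/-- The modulus of `a ^ (p z)` depends only on `Re z`, which ranges over the compact interval [0,
1]. -/
theorem isBigO_diagonalizedCpow_apply (ha : ∀ j, 0 < a j) (p : ℝ) (i j : ι) :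
    (fun z => diagonalizedCpow P a (p * z) i j) =O[Filter.principal
      (Complex.HadamardThreeLines.verticalClosedStrip 0 1)] (fun _ => (1 : ℝ)) := by
  simp only [diagonalizedCpow]
  simp only [mul_apply (N := Pᴴ), mul_diagonal]
  refine Asymptotics.IsBigO.fun_sum fun l _ => ?_
  have h : (fun z : ℂ => (a l : ℂ) ^ ((p : ℂ) * z)) =O[Filter.principal
      (Complex.HadamardThreeLines.verticalClosedStrip 0 1)] (fun _ => (1 : ℝ)) := by
    have hc : Continuous fun x : ℝ => a l ^ (p * x) :=
      Continuous.rpow continuous_const (by fun_prop) fun _ => Or.inl (ha l).ne'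
    obtain ⟨C, hC⟩ := (isCompact_Icc (a := (0 : ℝ)) (b := 1)).exists_bound_of_continuousOn
      hc.continuousOn
    refine Asymptotics.IsBigO.of_bound C (Filter.eventually_principal.mpr fun z hz => ?_)
    rw [Complex.norm_cpow_eq_rpow_re_of_pos (ha l), Complex.re_ofReal_mul, norm_one, mul_one]
    exact (le_abs_self _).trans (hC z.re hz)
  simpa using ((h.const_mul_left (P i l)).mul
    (Asymptotics.isBigO_const_const (Pᴴ l j) one_ne_zero _))

end diagonalizedCpow

theorem Matrix.PosDef.exists_rpow_eq_diagonalizedCpow {ι : Type*} [Fintype ι] [DecidableEq ι]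
    {A : Matrix ι ι ℂ} (hA : A.PosDef) :
    ∃ (P : Matrix ι ι ℂ) (a : ι → ℝ), Pᴴ * P = 1 ∧ P * Pᴴ = 1 ∧ (∀ j, 0 < a j) ∧
      ∀ x : ℝ, A ^ x = diagonalizedCpow P a x := by
  refine ⟨hA.1.eigenvectorUnitary, hA.1.eigenvalues, Unitary.coe_star_mul_self _,
    Unitary.coe_mul_star_self _, hA.eigenvalues_pos, fun x => ?_⟩
  rw [CFC.rpow_eq_cfc_real (nonneg_iff_posSemidef.mpr hA.posSemidef), hA.1.cfc_eq, IsHermitian.cfc,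
    Unitary.conjStarAlgAut_apply, diagonalizedCpow, star_eq_conjTranspose]
  congr 3; ext j
  simp [Complex.ofReal_cpow (hA.eigenvalues_pos j).le]

/-! ### Holomorphy and boundedness of matrix products and determinants. -/

section determinant

variable {ι κ : Type*}

theorem differentiable_matrix_mul_apply [Fintype ι] {κ' : Type*} {F : ℂ → Matrix κ ι ℂ} {G : ℂ → Matrix ι κ' ℂ}
    (hF : ∀ i j, Differentiable ℂ fun z => F z i j) (hG : ∀ i j, Differentiable ℂ fun z => G z i j)
    (i : κ) (j : κ') : Differentiable ℂ fun z => (F z * G z) i j := by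
  simp only [mul_apply]
  exact Differentiable.fun_sum fun l _ => (hF i l).mul (hG l j)

theorem differentiable_matrix_det [Fintype κ] [DecidableEq κ] {F : ℂ → Matrix κ κ ℂ}
    (hF : ∀ i j, Differentiable ℂ fun z => F z i j) : Differentiable ℂ fun z => (F z).det := by
  simp only [det_apply]
  refine Differentiable.fun_sum fun σ _ => Differentiable.const_smul ?_ _
  exact Differentiable.fun_finsetProd fun l _ => hF _ _

theorem isBigO_one_matrix_mul_apply [Fintype ι] {α κ' : Type*} {l : Filter α} {F : α → Matrix κ ι ℂ}
    {G : α → Matrix ι κ' ℂ} (hF : ∀ i j, (fun z => F z i j) =O[l] fun _ => (1 : ℝ))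
    (hG : ∀ i j, (fun z => G z i j) =O[l] fun _ => (1 : ℝ)) (i : κ) (j : κ') :
    (fun z => (F z * G z) i j) =O[l] fun _ => (1 : ℝ) := by
  simp only [mul_apply]
  exact Asymptotics.IsBigO.fun_sum fun m _ => by simpa using (hF i m).mul (hG m j)

theorem isBigO_one_matrix_det [Fintype κ] [DecidableEq κ] {α : Type*} {l : Filter α} {F : α → Matrix κ κ ℂ}
    (hF : ∀ i j, (fun z => F z i j) =O[l] fun _ => (1 : ℝ)) :
    (fun z => (F z).det) =O[l] fun _ => (1 : ℝ) := by
  simp only [det_apply']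
  refine Asymptotics.IsBigO.fun_sum fun σ _ => Asymptotics.IsBigO.const_mul_left ?_ _
  simpa using Asymptotics.IsBigO.finsetProd (s := Finset.univ)
    (f := fun i z => F z (σ i) i) (g := fun _ _ => (1 : ℝ)) fun i _ => hF (σ i) i

end determinant

/-! ### Interpolation by the three lines theorem. -/

open Complex.HadamardThreeLines in
/-- Heinz-type interpolation inequality for the products of the largest singular values. -/
theorem prod_singularValueVector_le_interp {n k : ℕ} (hk : k ≤ n)
    {A B : Matrix (Fin n) (Fin n) ℂ} (hA : A.PosDef) (hB : B.PosDef)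
    (X : Matrix (Fin n) (Fin n) ℂ) {p : ℝ} (hp : 1 ≤ p) :
    ∏ i : Fin k, singularValueVector (A * X * B) (Fin.castLE hk i) ≤
      (∏ i : Fin k, singularValueVector X (Fin.castLE hk i)) ^ (1 - p⁻¹) *
      (∏ i : Fin k, singularValueVector (A ^ p * X * B ^ p) (Fin.castLE hk i)) ^ p⁻¹ := by
  have hnn : ∀ M : Matrix (Fin n) (Fin n) ℂ,
      0 ≤ ∏ i : Fin k, singularValueVector M (Fin.castLE hk i) := fun M =>
    Finset.prod_nonneg fun _ _ => singularValueVector_nonneg _ _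
  by_cases h0 : ∏ i : Fin k, singularValueVector (A * X * B) (Fin.castLE hk i) = 0
  · rw [h0]
    exact mul_nonneg (Real.rpow_nonneg (hnn _) _) (Real.rpow_nonneg (hnn _) _)
  obtain ⟨U, V, hU, hV, hUV⟩ := exists_norm_det_compression_eq hk (A * X * B) h0
  obtain ⟨P, a, hP, hP', ha, hAP⟩ := hA.exists_rpow_eq_diagonalizedCpow
  obtain ⟨R, b, hR, hR', hb, hBR⟩ := hB.exists_rpow_eq_diagonalizedCpow
  set f : ℂ → ℂ := fun z =>
    (Uᴴ * (diagonalizedCpow P a (p * z) * X * diagonalizedCpow R b (p * z)) * V).det with hf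
  have hbound : ∀ z : ℂ, ‖f z‖ ≤ ∏ i : Fin k,
      singularValueVector (A ^ (p * z.re) * X * B ^ (p * z.re)) (Fin.castLE hk i) := fun z => by
    have hz : (p : ℂ) * z = ((p * z.re : ℝ) : ℂ) + ((p * z.im : ℝ) : ℂ) * Complex.I := by
      conv_lhs => rw [← Complex.re_add_im z]
      push_cast; ring
    -- Both orders of the sum are needed: the unitary factor must stand on the left of the power of
    -- `A`, next to `Uᴴ`, and on the right of the power of `B`, next to `V`.
    have hz' : (p : ℂ) * z = ((p * z.im : ℝ) : ℂ) * Complex.I + ((p * z.re : ℝ) : ℂ) := by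
      rw [hz, add_comm]
    set WA := diagonalizedCpow P a (((p * z.im : ℝ) : ℂ) * Complex.I) with hWA
    set WB := diagonalizedCpow R b (((p * z.im : ℝ) : ℂ) * Complex.I) with hWB
    have hWA1 : WA * WAᴴ = 1 :=
      mul_eq_one_comm.mp (conjTranspose_mul_diagonalizedCpow_I hP hP' ha _)
    have hWB1 : WBᴴ * WB = 1 := conjTranspose_mul_diagonalizedCpow_I hR hR' hb _
    have hU' : (WAᴴ * U)ᴴ * (WAᴴ * U) = 1 := by
      rw [conjTranspose_mul, conjTranspose_conjTranspose, Matrix.mul_assoc, ← Matrix.mul_assoc WA,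
        hWA1, Matrix.one_mul, hU]
    have hV' : (WB * V)ᴴ * (WB * V) = 1 := by
      rw [conjTranspose_mul, Matrix.mul_assoc, ← Matrix.mul_assoc WBᴴ, hWB1, Matrix.one_mul, hV]
    have := norm_det_compression_le hk (A ^ (p * z.re) * X * B ^ (p * z.re)) hU' hV'
    convert this using 3
    have hAz : diagonalizedCpow P a (p * z) = WA * A ^ (p * z.re) := by
      rw [hz', diagonalizedCpow_add hP ha, hAP]
    have hBz : diagonalizedCpow R b (p * z) = B ^ (p * z.re) * WB := by
      rw [hz, diagonalizedCpow_add hR hb, hBR]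
    rw [hAz, hBz]
    simp only [conjTranspose_mul, conjTranspose_conjTranspose, Matrix.mul_assoc]
  have hdiff : Differentiable ℂ f := by
    refine differentiable_matrix_det (differentiable_matrix_mul_apply
      (differentiable_matrix_mul_apply (fun i j => differentiable_const _)
        (differentiable_matrix_mul_apply (differentiable_matrix_mul_apply
          (differentiable_diagonalizedCpow_apply ha p) fun i j => differentiable_const _)
          (differentiable_diagonalizedCpow_apply hb p))) fun i j => differentiable_const _)
  have hO : f =O[Filter.principal (verticalClosedStrip 0 1)] fun _ => (1 : ℝ) := by
    have hc : ∀ c : ℂ, (fun _ : ℂ => c) =O[Filter.principal (verticalClosedStrip 0 1)]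
      fun _ => (1 : ℝ) := fun c => Asymptotics.isBigO_const_const c one_ne_zero _
    exact isBigO_one_matrix_det (isBigO_one_matrix_mul_apply
      (isBigO_one_matrix_mul_apply (fun i j => hc _)
        (isBigO_one_matrix_mul_apply (isBigO_one_matrix_mul_apply
          (isBigO_diagonalizedCpow_apply ha p) fun i j => hc _)
          (isBigO_diagonalizedCpow_apply hb p))) fun i j => hc _)
  have hbdd : BddAbove ((norm ∘ f) '' verticalClosedStrip 0 1) := by
    obtain ⟨C, hC⟩ := hO.bound
    refine ⟨C, ?_⟩
    rintro _ ⟨z, hz, rfl⟩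
    simpa using Filter.eventually_principal.mp hC z hz
  have hp0 : 0 < p := by linarith
  have hA0 : (0 : Matrix (Fin n) (Fin n) ℂ) ≤ A := nonneg_iff_posSemidef.mpr hA.posSemidef
  have hB0 : (0 : Matrix (Fin n) (Fin n) ℂ) ≤ B := nonneg_iff_posSemidef.mpr hB.posSemidef
  have key := norm_le_interp_of_mem_verticalClosedStrip₀₁' f (z := ((p⁻¹ : ℝ) : ℂ))
    (a := ∏ i : Fin k, singularValueVector X (Fin.castLE hk i))
    (b := ∏ i : Fin k, singularValueVector (A ^ p * X * B ^ p) (Fin.castLE hk i))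
    ⟨by rw [Complex.ofReal_re]; positivity, by rw [Complex.ofReal_re]; exact inv_le_one_of_one_le₀ hp⟩
    hdiff.diffContOnCl hbdd
    (fun z hz => by
      have h := hbound z
      rw [Set.mem_preimage, Set.mem_singleton_iff] at hz
      rwa [hz, mul_zero, CFC.rpow_zero A hA0, CFC.rpow_zero B hB0, Matrix.one_mul, Matrix.mul_one] at h)
    (fun z hz => by
      have h := hbound z
      rw [Set.mem_preimage, Set.mem_singleton_iff] at hz
      rwa [hz, mul_one] at h)
  have hfp : ‖f ((p⁻¹ : ℝ) : ℂ)‖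
      = ∏ i : Fin k, singularValueVector (A * X * B) (Fin.castLE hk i) := by
    have h1 : (p : ℂ) * ((p⁻¹ : ℝ) : ℂ) = ((1 : ℝ) : ℂ) := by
      rw [← Complex.ofReal_mul, mul_inv_cancel₀ hp0.ne']
    rw [← hUV, hf]
    simp only [h1]
    rw [← hAP, ← hBR, CFC.rpow_one A hA0, CFC.rpow_one B hB0]
  rwa [hfp, Complex.ofReal_re] at key

/-! ### Log-majorization. -/

theorem prod_filter_val_lt {n k : ℕ} (hk : k ≤ n) (x : Fin n → ℝ) :
    ∏ j ∈ Finset.univ.filter (fun j : Fin n => (j : ℕ) < k), x j =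
      ∏ i : Fin k, x (Fin.castLE hk i) := by
  symm
  refine Finset.prod_bij (fun i _ => Fin.castLE hk i) (by simp)
    (fun i _ j _ h => Fin.castLE_injective hk h) (fun j hj => ?_) (fun _ _ => rfl)
  exact ⟨⟨j, (Finset.mem_filter.mp hj).2⟩, Finset.mem_univ _, rfl⟩

theorem Matrix.PosDef.norm_det_rpow {n : ℕ} {A : Matrix (Fin n) (Fin n) ℂ} (hA : A.PosDef) (x : ℝ) :
    ‖(A ^ x).det‖ = ‖A.det‖ ^ x := by
  obtain ⟨P, a, hP, hP', ha, hAP⟩ := hA.exists_rpow_eq_diagonalizedCpow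
  have h : ∀ y : ℝ, ‖(A ^ y).det‖ = ∏ j, a j ^ y := fun y => by
    rw [hAP, diagonalizedCpow, det_mul_right_comm, hP', Matrix.one_mul, det_diagonal, norm_prod]
    refine Finset.prod_congr rfl fun j _ => ?_
    rw [Complex.norm_cpow_eq_rpow_re_of_pos (ha j), Complex.ofReal_re]
  have h1 := h 1
  rw [CFC.rpow_one A (nonneg_iff_posSemidef.mpr hA.posSemidef)] at h1
  rw [h, h1, ← Real.finsetProd_rpow _ _ fun j _ => by simpa using (ha j).le]
  simp

theorem logMajorizes_rpow_mul_mul_rpow {n : ℕ} {A B : Matrix (Fin n) (Fin n) ℂ} (hA : A.PosDef)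
    (hB : B.PosDef) (X : Matrix (Fin n) (Fin n) ℂ) {r : ℝ} (hr : 0 ≤ r) :
    LogMajorizes (singularValueVector (A ^ (1 + r) * X * B ^ (1 + r)))
      (fun j => singularValueVector (A * X * B) j ^ (1 + r) * singularValueVector X j ^ (-r)) := by
  have hr1 : 0 < 1 + r := by linarith
  constructor
  · intro k _ hkn
    rw [prod_filter_val_lt hkn.le, prod_filter_val_lt hkn.le, Finset.prod_mul_distrib,
      Real.finsetProd_rpow _ _ fun j _ => singularValueVector_nonneg _ _,
      Real.finsetProd_rpow _ _ fun j _ => singularValueVector_nonneg _ _]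
    have h := prod_singularValueVector_le_interp hkn.le hA hB X (p := 1 + r) (by linarith)
    have hnn : ∀ M : Matrix (Fin n) (Fin n) ℂ,
        0 ≤ ∏ i : Fin k, singularValueVector M (Fin.castLE hkn.le i) := fun M =>
      Finset.prod_nonneg fun _ _ => singularValueVector_nonneg _ _
    have hS := hnn (A * X * B)
    have hT := hnn X
    have hQ := hnn (A ^ (1 + r) * X * B ^ (1 + r))
    set S := ∏ i : Fin k, singularValueVector (A * X * B) (Fin.castLE hkn.le i)
    set T := ∏ i : Fin k, singularValueVector X (Fin.castLE hkn.le i)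
    set Q := ∏ i : Fin k, singularValueVector (A ^ (1 + r) * X * B ^ (1 + r)) (Fin.castLE hkn.le i)
    have h2 : S ^ (1 + r) ≤ T ^ r * Q := by
      have := Real.rpow_le_rpow hS h hr1.le
      rwa [Real.mul_rpow (Real.rpow_nonneg hT _) (Real.rpow_nonneg hQ _), ← Real.rpow_mul hT,
        ← Real.rpow_mul hQ, inv_mul_cancel₀ hr1.ne', Real.rpow_one, sub_mul, one_mul,
        inv_mul_cancel₀ hr1.ne', add_sub_cancel_left] at this
    -- `r = 0` is separate because `0 ^ 0 = 1`; for `r > 0` the convention `0 ^ (-r) = 0` makes the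
    -- left side vanish when `T = 0`.
    rcases hr.eq_or_lt with rfl | hr0
    · simpa using h2
    rcases hT.eq_or_lt with hT0 | hT0
    · rw [← hT0, Real.zero_rpow (by linarith), mul_zero]; exact hQ
    · rw [Real.rpow_neg hT, ← div_eq_mul_inv, div_le_iff₀ (Real.rpow_pos_of_pos hT0 _), mul_comm Q]
      exact h2
  · rw [Finset.prod_mul_distrib,
      Real.finsetProd_rpow _ _ fun j _ => singularValueVector_nonneg _ _,
      Real.finsetProd_rpow _ _ fun j _ => singularValueVector_nonneg _ _,
      prod_singularValueVector, prod_singularValueVector, prod_singularValueVector]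
    simp only [det_mul, norm_mul, hA.norm_det_rpow, hB.norm_det_rpow]
    rw [Real.mul_rpow (by positivity) (by positivity), Real.mul_rpow (by positivity) (by positivity)]
    have : ‖X.det‖ ^ (1 + r) * ‖X.det‖ ^ (-r) = ‖X.det‖ := by
      rcases (norm_nonneg X.det).eq_or_lt with h0 | h0
      · rw [← h0, Real.zero_rpow hr1.ne', zero_mul]
      · rw [← Real.rpow_add h0]; simp
    linear_combination ‖A.det‖ ^ (1 + r) * ‖B.det‖ ^ (1 + r) * this

theorem Matrix.PosDef.inv_rpow {ι : Type*} [Fintype ι] [DecidableEq ι]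
    {B : Matrix ι ι ℂ} (hB : B.PosDef) {x : ℝ} : B⁻¹ ^ x = B ^ (-x) := by
  obtain ⟨u, rfl⟩ := hB.isUnit
  rw [CFC.rpow_neg u x (nonneg_iff_posSemidef.mpr hB.posSemidef), coe_units_inv]

/-- Powers of positive definite matrices are those of the functional calculus. Where `X` is
singular, an entry with `s_j(X) = 0` (resp. `s_j(X B) = 0`) also has `s_j(A X B) = 0`
(resp. `s_j(A X) = 0`), so that entry of the right-hand vector is `0`. -/
theorem mainTheorem11 (n : ℕ) (A B X : Matrix (Fin n) (Fin n) ℂ)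
    (hA : A.PosDef) (hB : B.PosDef) (r : ℝ) (hr : 0 ≤ r) :
    LogMajorizes (singularValueVector (A ^ (1 + r) * X * B ^ (1 + r)))
      (fun j => singularValueVector (A * X * B) j ^ (1 + r) * singularValueVector X j ^ (-r)) ∧
    LogMajorizes (singularValueVector (A ^ (1 + r) * X * B ^ (-r)))
      (fun j => singularValueVector (A * X) j ^ (1 + r) *
        singularValueVector (X * B) j ^ (-r)) := by

  refine ⟨logMajorizes_rpow_mul_mul_rpow hA hB X hr, ?_⟩
  -- The extra `B` cancels `B⁻¹` in `A (X B) B⁻¹` and lowers the exponent `1 + r` of `B⁻¹` to `r`.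
  have h := logMajorizes_rpow_mul_mul_rpow hA hB.inv (X * B) hr
  have hu : IsUnit B.det := (isUnit_iff_isUnit_det B).mp hB.isUnit
  have h1 : A * (X * B) * B⁻¹ = A * X := by
    rw [← Matrix.mul_assoc, mul_nonsing_inv_cancel_right B _ hu]
  have h2 : A ^ (1 + r) * (X * B) * B⁻¹ ^ (1 + r) = A ^ (1 + r) * X * B ^ (-r) := by
    have h3 : B * B ^ (-(1 + r)) = B ^ (-r) := by
      have h4 := CFC.rpow_add (x := 1) (y := -(1 + r)) hB.isUnit
      rw [CFC.rpow_one B (nonneg_iff_posSemidef.mpr hB.posSemidef)] at h4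
      rw [← h4]; congr 1; ring
    rw [hB.inv_rpow, ← Matrix.mul_assoc, Matrix.mul_assoc _ B, h3]
  rwa [h1, h2] at h
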